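/- **Setting.** Let $\mathcal A$ be a finite set, $D\ge 1$, and let $\mathfrak A\subset\mathcal A^{\mathbb Z^D}$ be a subshift (closed and invariant under the shifts $\sigma^{v}(\mathbf a)_z=a_{z+v}$). Write $\mathbb B(z,r)=z+\{-r,\dots,r\}^D$ and $|z|=\sum_i|z_i|$. For $\mathbf a\in\mathcal A^{\mathbb Z^D}$ let $F_{\mathbf a}(z)\in\mathbb N\cup\{\infty\}$ be the largest $r$ such that $\mathbf a_{\mathbb B(z,r)}$ is, up to translation, the restriction to $\mathbb B(0,r)$ of an element of $\mathfrak A$ ($0$ if there is none), and let $\mathbb G_r(\mathbf a)=\{z: F_{\mathbf a}(z)\ge r\}$. Let $\widetilde{\mathfrak A}=\{\mathbf a:\sup_z F_{\mathbf a}(z)=\infty\}$; $\mathbf a$ is *defective* if $\mathbf a\in\widetilde{\mathfrak A}\setminus\mathfrak A$. The defect of $\mathbf a\in\widetilde{\mathfrak A}$ is *essential* if there are no $r>0$ and $\mathbf a'\in\mathfrak A$ with $a'_z=a_z$ for all $z\in\mathbb G_r(\mathbf a)$. It is *$\Phi$-persistent*, for a cellular automaton $\Phi$, if $\Phi^t(\mathbf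 a)$ is defective for every $t\in\mathbb N$. Let $\mathcal G$ be a discrete group with a pseudonorm $|\cdot|:\mathcal G\to[0,\infty)$, that is, $|gh|=|hg|$ and $|gh|\le|g|+|h|$. A *cocycle* is a continuous $C:\mathbb Z^D\times\mathfrak A\to\mathcal G$ with $C(y+z,\mathbf x)=C(y,\sigma^z\mathbf x)\,C(z,\mathbf x)$. Cocycles $C,C'$ are cohomologous if $C'(z,\mathbf x)=b(\sigma^z\mathbf x)\,C(z,\mathbf x)\,b(\mathbf x)^{-1}$ for a continuous $b:\mathfrak A\to\mathcal G$; $H^1_{dy}(\mathfrak A,\mathcal G)$ is the set of cohomology classes. $C$ has radius $\rho$ if, for every unit vector $e=(0,\dots,\pm1,\dots,0)$, $C(e,\mathbf x)$ depends only on $\mathbf x_{\mathbb B(0,\rho)}$. If $\Phi$ is a cellular automaton with $\Phi(\mathfrak A)\subseteq\mathfrak A$, then $\Phi_*$ is the self-map of $H^1_{dy}(\mathfrak A,\mathcal G)$ induced by $(\Phi_*C)(z,\mathbf x)=C(z,\Phi(\mathbf x))$. A *trail* is a finite sequence of points of $\mathbb Z^D$ with successive distances $1$; components of subsets of $\mathbb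 Z^D$ are trail-connected components. A component $Y$ of $\mathbb G_r(\mathbf a)$ is *projective* if $Y\cap\mathbb G_R(\mathbf a)\ne\emptyset$ for all $R\ge r$. If $C$ has radius $\rho<r$, $\mathbf a\in\widetilde{\mathfrak A}$, and $Y$ is a component of $\mathbb G_r(\mathbf a)$ with $\pi_1(Y)=0$ (trails in $Y$ modulo replacing one interior vertex and inserting or deleting backtracks), let $C_{\mathbf a}(y,z)$, for $y,z\in Y$, be the product of the local rule of $C$ along any trail in $Y$ from $z$ to $y$. Then $\mathbf a$ has a *$C$-gap of range $r$* if $\mathbb G_r(\mathbf a)$ has two distinct projective components $Y_1,Y_2$ with $\pi_1(Y_1)=\pi_1(Y_2)=0$ and, for some $p_i\in Y_i$, $$\sup_{y_1\in Y_1,\;y_2\in Y_2}\frac{|C_{\mathbf a}(y_1,p_1)\,C_{\mathbf a}(p_2,y_2)|}{|y_1-y_2|}=\infty .$$ - $\mathbf a$ has a *$\mathcal G$-gap* if, for some $\mathcal G$-valued cocycle $C$, it has $C$-gaps of arbitrarily large range. - $\mathbf a$ has a *sharp $\mathcal G$-gap* if, for some $\mathcal G$-valued cocycle $C$ and some single $r$,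 it has a $C$-gap of range $r$; for every $r$ the set $\mathbb G_r(\mathbf a)$ has only finitely many projective components; and for all $R\ge r\ge0$ there is $K$ such that every $y\in\mathbb G_r(\mathbf a)$ is joined to some $x\in\mathbb G_R(\mathbf a)$ by a trail in $\mathbb G_r(\mathbf a)$ of length at most $K$. **Theorem.** Let $\mathbf a\in\mathcal A^{\mathbb Z^D}$ have a sharp $\mathcal G$-gap or a $\mathcal G$-gap. (a) The defect of $\mathbf a$ is essential. (b) If $\Phi:\mathcal A^{\mathbb Z^D}\to\mathcal A^{\mathbb Z^D}$ is a cellular automaton with $\Phi(\mathfrak A)\subseteq\mathfrak A$ and $\Phi_*:H^1_{dy}(\mathfrak A,\mathcal G)\to H^1_{dy}(\mathfrak A,\mathcal G)$ is surjective, then the defect of $\mathbf a$ is $\Phi$-persistent. -/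

import Mathlib

open scoped NNReal ENNReal

namespace CADefects

/-- The lattice `ℤ^D`. -/
abbrev Lat (D : ℕ) := Fin D → ℤ

/-- Configurations on `ℤ^D`, with the product topology when `A` is discrete. -/
abbrev Config (D : ℕ) (A : Type*) := Lat D → A

/-- The `ℓ¹` distance on `ℤ^D`. -/
def dist1 {D : ℕ} (y z : Lat D) : ℕ := ∑ i, (y i - z i).natAbs

/-- Two lattice points are adjacent if they differ by a unit vector `(0,…,±1,…,0)`. -/
def Adjacent {D : ℕ} (y z : Lat D) : Prop := dist1 y z = 1

/-- The cube `{-r,…,r}^D`. -/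
def cube (D r : ℕ) : Set (Lat D) := {v | ∀ i, |v i| ≤ (r : ℤ)}

/-- The shift: `(shift v a) z = a (z + v)`. -/
def shift {D : ℕ} {A : Type*} (v : Lat D) (a : Config D A) : Config D A := fun z => a (z + v)

/-- A subshift: a closed, shift-invariant set of configurations. -/
structure Subshift (D : ℕ) (A : Type*) [TopologicalSpace A] where
  carrier : Set (Config D A)
  isClosed : IsClosed carrier
  shift_mem : ∀ v, ∀ a ∈ carrier, shift v a ∈ carrier

/-- A cellular automaton: a continuous map commuting with all shifts. -/
structure CellularAutomaton (D : ℕ) (A : Type*) [TopologicalSpace A] where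
  toFun : Config D A → Config D A
  continuous : Continuous toFun
  comm : ∀ v a, toFun (shift v a) = shift v (toFun a)

namespace Subshift

variable {D : ℕ} {A : Type*} [TopologicalSpace A]

/-- The shift as a self-map of a subshift. -/
def shiftOn (S : Subshift D A) (v : Lat D) (x : S.carrier) : S.carrier :=
  ⟨shift v x.1, S.shift_mem v x.1 x.2⟩

/-- `x` and the translate of `a` by `z` agree on the cube of radius `r`. -/
def Matches (S : Subshift D A) (r : ℕ) (a : Config D A) (z : Lat D) (x : S.carrier) : Prop :=
  ∀ v ∈ cube D r, x.1 v = a (z + v)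

/-- The defect field: the largest `r` such that the block of `a` of radius `r` around `z`
occurs in an element of the subshift. -/
noncomputable def defectField (S : Subshift D A) (a : Config D A) (z : Lat D) : ℕ∞ :=
  sSup {n : ℕ∞ | ∃ r : ℕ, n = (r : ℕ∞) ∧ ∃ x, S.Matches r a z x}

/-- The points at which the defect field is at least `R`. -/
def unflawed (S : Subshift D A) (R : ℕ) (a : Config D A) : Set (Lat D) :=
  {z | (R : ℕ∞) ≤ S.defectField a z}

/-- The slightly defective configurations: those whose defect field is unbounded. -/
def slightlyDefective (S : Subshift D A) : Set (Config D A) :=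
  {a | ⨆ z, S.defectField a z = ⊤}

/-- Defective configurations. -/
def Defective (S : Subshift D A) (a : Config D A) : Prop :=
  a ∈ S.slightlyDefective ∧ a ∉ S.carrier

/-- The defect can be erased by changing `a` within a bounded distance of the flawed region. -/
def Removable (S : Subshift D A) (a : Config D A) : Prop :=
  ∃ r : ℕ, 0 < r ∧ ∃ a' ∈ S.carrier, ∀ z ∈ S.unflawed r a, a' z = a z

/-- `a` has an essential defect: it is slightly defective and its defect is not removable. -/
def Essential (S : Subshift D A) (a : Config D A) : Prop :=
  a ∈ S.slightlyDefective ∧ ¬ S.Removable a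

/-- `a` has a `Φ`-persistent defect: every `Φ^t a`, `t ∈ ℕ`, is defective. -/
def Persistent (S : Subshift D A) (Φ : CellularAutomaton D A) (a : Config D A) : Prop :=
  ∀ t : ℕ, S.Defective (Φ.toFun^[t] a)

end Subshift

section Trails

variable {D : ℕ}

/-- `ζ` is a trail inside `Y` from `x` to `y`. -/
structure IsTrail (Y : Set (Lat D)) (x y : Lat D) (ζ : List (Lat D)) : Prop where
  chain : ζ.IsChain Adjacent
  mem : ∀ z ∈ ζ, z ∈ Y
  head : ζ.head? = some x
  last : ζ.getLast? = some y

/-- `Y` is a trail-connected component of `T`. -/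
def IsComponent (T Y : Set (Lat D)) : Prop :=
  ∃ x ∈ T, Y = {y | ∃ ζ, IsTrail T x y ζ}

/-- Elementary homotopies of trails: replacing an interior vertex, or deleting or inserting a
backtrack. -/
inductive ElemHomotopy : List (Lat D) → List (Lat D) → Prop
  | swap (l m : List (Lat D)) (w x x' y : Lat D) :
      ElemHomotopy (l ++ w :: x :: y :: m) (l ++ w :: x' :: y :: m)
  | delete (l m : List (Lat D)) (w x : Lat D) :
      ElemHomotopy (l ++ w :: x :: w :: m) (l ++ w :: m)
  | insert (l m : List (Lat D)) (w x : Lat D) :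
      ElemHomotopy (l ++ w :: m) (l ++ w :: x :: w :: m)

/-- Homotopy, inside `Y`, of trails from `x` to `y`: a finite chain of trails in `Y`, successive
ones differing by an elementary homotopy. -/
def TrailHomotopic (Y : Set (Lat D)) (x y : Lat D) : List (Lat D) → List (Lat D) → Prop :=
  Relation.ReflTransGen
    (fun ζ ζ' => IsTrail Y x y ζ ∧ IsTrail Y x y ζ' ∧ ElemHomotopy ζ ζ')

/-- `π₁(Y) = 0`: every closed trail in `Y` is homotopic in `Y` to a constant trail. -/
def TrivialPi1 (Y : Set (Lat D)) : Prop :=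
  ∀ x ζ, IsTrail Y x x ζ → TrailHomotopic Y x x ζ [x]

end Trails

/-- A `G`-valued continuous dynamical cocycle on a subshift. -/
structure Cocycle {D : ℕ} {A : Type*} [TopologicalSpace A] (S : Subshift D A)
    (G : Type*) [Group G] [TopologicalSpace G] where
  toFun : Lat D → S.carrier → G
  continuous : Continuous fun p : Lat D × S.carrier => toFun p.1 p.2
  cocycle : ∀ y z x, toFun (y + z) x = toFun y (S.shiftOn z x) * toFun z x

namespace Cocycle

variable {D : ℕ} {A : Type*} [TopologicalSpace A] {S : Subshift D A}
  {G : Type*} [Group G] [TopologicalSpace G]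

/-- Two cocycles are cohomologous if they differ by a continuous transfer function. -/
def Cohomologous (C C' : Cocycle S G) : Prop :=
  ∃ b : S.carrier → G, Continuous b ∧
    ∀ z x, C'.toFun z x = b (S.shiftOn z x) * C.toFun z x * (b x)⁻¹

/-- `C` is locally determined with radius `ρ`: for every unit vector `e`, `C(e,x)` depends only
on the block of `x` in the cube of radius `ρ`. -/
def HasRadius (C : Cocycle S G) (ρ : ℕ) : Prop :=
  ∀ e, Adjacent 0 e → ∀ x y : S.carrier, (∀ v ∈ cube D ρ, x.1 v = y.1 v) →
    C.toFun e x = C.toFun e y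

open Classical in
/-- The local rule of `C`, of radius `r`, applied to the unit vector `e` and to the block of `a`
of radius `r` around `z`; it is meant for `z ∈ S.unflawed r a` and `C.HasRadius r`. -/
noncomputable def localRule (C : Cocycle S G) (r : ℕ) (a : Config D A) (e z : Lat D) : G :=
  if h : ∃ x, S.Matches r a z x then C.toFun e h.choose else 1

/-- The value of the local rule along a trail (later steps are multiplied on the left). -/
noncomputable def alongTrail (C : Cocycle S G) (r : ℕ) (a : Config D A) : List (Lat D) → G
  | [] => 1
  | [_] => 1
  | z :: w :: l => C.alongTrail r a (w :: l) * C.localRule r a (w - z) z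

open Classical in
/-- `C_a(y,z)` for `y, z` in a common component `Y`: the value of the local rule along any trail in
`Y` from `z` to `y`. -/
noncomputable def diffWithin (C : Cocycle S G) (r : ℕ) (a : Config D A) (Y : Set (Lat D))
    (y z : Lat D) : G :=
  if h : ∃ ζ, IsTrail Y z y ζ then C.alongTrail r a h.choose else 1

end Cocycle

/-- The set `H¹_dy(S,G)` of cohomology classes of continuous cocycles. -/
def cohomologySetoid {D : ℕ} {A : Type*} [TopologicalSpace A] (S : Subshift D A)
    (G : Type*) [Group G] [TopologicalSpace G] [IsTopologicalGroup G] : Setoid (Cocycle S G) where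
  r := Cocycle.Cohomologous
  iseqv :=
    { refl := fun C => ⟨fun _ => 1, continuous_const, by intros; simp⟩
      symm := by
        rintro C C' ⟨b, hb, h⟩
        refine ⟨fun x => (b x)⁻¹, hb.inv, fun z x => ?_⟩
        rw [h]; group
      trans := by
        rintro C C' C'' ⟨b, hb, h⟩ ⟨b', hb', h'⟩
        refine ⟨fun x => b' x * b x, hb'.mul hb, fun z x => ?_⟩
        rw [h', h]; group }

/-- The first dynamical cohomology of a subshift with coefficients in `G`. -/
def H1dy {D : ℕ} {A : Type*} [TopologicalSpace A] (S : Subshift D A)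
    (G : Type*) [Group G] [TopologicalSpace G] [IsTopologicalGroup G] : Type _ :=
  Quotient (cohomologySetoid S G)

namespace CellularAutomaton

variable {D : ℕ} {A : Type*} [TopologicalSpace A]

/-- `Φ(S) ⊆ S`. -/
def Preserves (Φ : CellularAutomaton D A) (S : Subshift D A) : Prop :=
  ∀ x ∈ S.carrier, Φ.toFun x ∈ S.carrier

/-- The restriction of `Φ` to a subshift which it preserves. -/
def restrict (Φ : CellularAutomaton D A) {S : Subshift D A} (h : Φ.Preserves S)
    (x : S.carrier) : S.carrier :=
  ⟨Φ.toFun x.1, h x.1 x.2⟩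

theorem continuous_restrict (Φ : CellularAutomaton D A) {S : Subshift D A} (h : Φ.Preserves S) :
    Continuous (Φ.restrict h) :=
  (Φ.continuous.comp continuous_subtype_val).subtype_mk _

theorem restrict_shiftOn (Φ : CellularAutomaton D A) {S : Subshift D A} (h : Φ.Preserves S)
    (z : Lat D) (x : S.carrier) :
    Φ.restrict h (S.shiftOn z x) = S.shiftOn z (Φ.restrict h x) :=
  Subtype.ext (Φ.comm z x.1)

variable {G : Type*} [Group G] [TopologicalSpace G]

/-- `(Φ_* C)(z,x) = C(z,Φ(x))`. -/
def pullCocycle (Φ : CellularAutomaton D A) {S : Subshift D A} (h : Φ.Preserves S)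
    (C : Cocycle S G) : Cocycle S G where
  toFun z x := C.toFun z (Φ.restrict h x)
  continuous := C.continuous.comp
    (continuous_fst.prodMk ((Φ.continuous_restrict h).comp continuous_snd))
  cocycle y z x := by rw [C.cocycle, Φ.restrict_shiftOn h]

/-- The map `Φ_*` induced by `Φ` on `H¹_dy(S,G)`. -/
def inducedMap [IsTopologicalGroup G] (Φ : CellularAutomaton D A) {S : Subshift D A}
    (h : Φ.Preserves S) : H1dy S G → H1dy S G :=
  Quotient.map (Φ.pullCocycle h) (by
    rintro C C' ⟨b, hb, hC⟩
    refine ⟨fun x => b (Φ.restrict h x), hb.comp (Φ.continuous_restrict h), fun z x => ?_⟩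
    simp only [pullCocycle, hC, Φ.restrict_shiftOn h])

end CellularAutomaton

/-- A pseudonorm on a group. It is finite-valued, as is any pseudonorm that is bounded on a finite
symmetric generating set. -/
structure Pseudonorm (G : Type*) [Group G] where
  toFun : G → ℝ≥0
  comm : ∀ g h, toFun (g * h) = toFun (h * g)
  subadd : ∀ g h, toFun (g * h) ≤ toFun g + toFun h

section Gaps

variable {D : ℕ} {A : Type*} [TopologicalSpace A] (S : Subshift D A)
  {G : Type*} [Group G] [TopologicalSpace G] (N : Pseudonorm G)

/-- `Y` is a projective component of `S.unflawed r a`. -/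
def IsProjectiveComponent (r : ℕ) (a : Config D A) (Y : Set (Lat D)) : Prop :=
  IsComponent (S.unflawed r a) Y ∧ ∀ R, r ≤ R → (Y ∩ S.unflawed R a).Nonempty

/-- For every range `r`, there are only finitely many projective components. -/
def FinitelyManyDomains (a : Config D A) : Prop :=
  ∀ r : ℕ, {Y | IsProjectiveComponent S r a Y}.Finite

variable {S}

/-- The tilt of `Y₁` relative to `Y₂`, with reference points `p₁` and `p₂`: the supremum of
`|C_a(y₁,y₂)| / |y₁ - y₂|`, where `C_a(y₁,y₂) = C_a(y₁,p₁) C_a(p₂,y₂)`. -/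
noncomputable def tilt (C : Cocycle S G) (r : ℕ) (a : Config D A) (Y₁ Y₂ : Set (Lat D))
    (p₁ p₂ : Lat D) : ℝ≥0∞ :=
  ⨆ y₁ ∈ Y₁, ⨆ y₂ ∈ Y₂,
    (N.toFun (C.diffWithin r a Y₁ y₁ p₁ * C.diffWithin r a Y₂ p₂ y₂) : ℝ≥0∞) / (dist1 y₁ y₂ : ℝ≥0∞)

/-- The domain boundary of range `r` in `a` is a `C`-gap: between two distinct simply connected
projective components of `S.unflawed r a`, the tilt is infinite. The range exceeds a radius of `C`,
so that the values of the local rule along homotopic trails coincide. -/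
def IsGapOfRange (C : Cocycle S G) (r : ℕ) (a : Config D A) : Prop :=
  a ∈ S.slightlyDefective ∧ (∃ ρ < r, C.HasRadius ρ) ∧
  ∃ Y₁ Y₂, IsProjectiveComponent S r a Y₁ ∧ IsProjectiveComponent S r a Y₂ ∧ Y₁ ≠ Y₂ ∧
    TrivialPi1 Y₁ ∧ TrivialPi1 Y₂ ∧
    ∃ p₁ ∈ Y₁, ∃ p₂ ∈ Y₂, tilt N C r a Y₁ Y₂ p₁ p₂ = ⊤

variable (S)

/-- Sharpness: for all `R ≥ r ≥ 0` there is `K` such that every point of `S.unflawed r a` is joined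
to a point of `S.unflawed R a` by a trail in `S.unflawed r a` with at most `K` steps. -/
def Sharp (a : Config D A) : Prop :=
  ∀ r R : ℕ, r ≤ R → ∃ K : ℕ, ∀ y ∈ S.unflawed r a, ∃ x ∈ S.unflawed R a,
    ∃ ζ, IsTrail (S.unflawed r a) y x ζ ∧ ζ.length ≤ K + 1

/-- `a` has a sharp gap, of some single range, for some `G`-valued cocycle. -/
def HasSharpGap (a : Config D A) : Prop :=
  Sharp S a ∧ FinitelyManyDomains S a ∧ ∃ (C : Cocycle S G) (r : ℕ), IsGapOfRange N C r a

/-- `a` has a `G`-gap: for some `G`-valued cocycle `C`, there are `C`-gaps of arbitrarily large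
range. -/
def HasGap (a : Config D A) : Prop :=
  ∃ C : Cocycle S G, ∀ r₀ : ℕ, ∃ r, r₀ ≤ r ∧ IsGapOfRange N C r a

end Gaps

end CADefects

/-! Both parts are proved by contradiction from one notion, `IsBlockPotential`: a single function
`h` on all of `ℤ^D` whose increments `h w * (h z)⁻¹` are the values of the cocycle read off blocks
of `a` of some radius `R`. If every cocycle has such an `h` of linear growth, there is no gap
(`not_hasGap_of_forall_blockPotential`).

Sources of `h`. If the defect is removable with repair `a'`, take `h y = C(y, a')`. If `Φ^t(a)` lies
in the subshift, surjectivity of `Φ_*`, hence of its iterates, writes `C` as the pullback of some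
`C'` up to a transfer function `b`; take `h y = b(block at y) * C'(y, Φ^t(a))`. By compactness `b`
has finitely many values, and a cocycle grows linearly along an orbit, so `h` grows linearly.

Why `h` excludes gaps. For `r ≥ R`, the product in the tilt is `h y₁ * (h p₁)⁻¹ * h p₂ * (h y₂)⁻¹`.
The trace-like law `|gh| = |hg|` bounds it by `|h y₁ * (h y₂)⁻¹|` plus a constant, and distinct
components are at distance at least 1, so the tilt is finite. A sharp gap may have `r < R`. Then
each `yᵢ` is moved a bounded distance to a point of range at least `R`; there `h` and the potential
of `Yᵢ` differ by a right factor constant on components, and sharpness with finiteness of the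
projective components leaves finitely many factors. -/

namespace CADefects

/-! ### Geometry of the lattice and its cubes. -/

section Lattice

variable {D : ℕ}

theorem dist1_comm (y z : Lat D) : dist1 y z = dist1 z y :=
  Finset.sum_congr rfl fun i _ => by omega

theorem dist1_self (y : Lat D) : dist1 y y = 0 := by simp [dist1]

theorem dist1_triangle (x y z : Lat D) : dist1 x z ≤ dist1 x y + dist1 y z := by
  unfold dist1
  rw [← Finset.sum_add_distrib]
  exact Finset.sum_le_sum fun i _ => by omega

theorem eq_of_dist1_eq_zero {y z : Lat D} (h : dist1 y z = 0) : y = z := by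
  funext i
  have := (Finset.sum_eq_zero_iff.1 h) i (Finset.mem_univ i)
  omega

theorem natAbs_sub_le_dist1 (y z : Lat D) (i : Fin D) : (y i - z i).natAbs ≤ dist1 y z :=
  Finset.single_le_sum (f := fun i => (y i - z i).natAbs) (fun _ _ => Nat.zero_le _)
    (Finset.mem_univ i)

theorem dist1_sub_zero (y z : Lat D) : dist1 (y - z) 0 = dist1 y z := by simp [dist1]

theorem Adjacent.symm {y z : Lat D} (h : Adjacent y z) : Adjacent z y := by
  rwa [Adjacent, dist1_comm]

theorem Adjacent.sub {y z : Lat D} (h : Adjacent y z) : Adjacent 0 (z - y) := by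
  rw [Adjacent, dist1_comm, dist1_sub_zero]
  exact h.symm

theorem Adjacent.mem_cube_one {e : Lat D} (h : Adjacent 0 e) : e ∈ cube D 1 := by
  intro i
  have h1 := natAbs_sub_le_dist1 0 e i
  rw [h] at h1
  simp only [Pi.zero_apply, zero_sub, Int.natAbs_neg] at h1
  exact abs_le.2 ⟨by push_cast; omega, by push_cast; omega⟩

theorem cube_mono {r s : ℕ} (h : r ≤ s) : cube D r ⊆ cube D s :=
  fun _ hv i => (hv i).trans (by exact_mod_cast h)

theorem add_mem_cube {r s : ℕ} {v w : Lat D} (hv : v ∈ cube D r) (hw : w ∈ cube D s) :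
    v + w ∈ cube D (r + s) := fun i => by
  have := hv i
  have := hw i
  have := abs_add_le (v i) (w i)
  simp only [Pi.add_apply]
  push_cast
  omega

theorem finite_cube (D r : ℕ) : (cube D r).Finite := by
  refine (Set.finite_Icc (fun _ : Fin D => -(r : ℤ)) (fun _ => (r : ℤ))).subset fun v hv => ?_
  exact ⟨fun i => (abs_le.1 (hv i)).1, fun i => (abs_le.1 (hv i)).2⟩

theorem finite_units (D : ℕ) : {e : Lat D | Adjacent 0 e}.Finite :=
  (finite_cube D 1).subset fun _ h => Adjacent.mem_cube_one h

theorem exists_mem_cube (v : Lat D) : ∃ r, v ∈ cube D r := by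
  refine ⟨dist1 v 0, fun i => ?_⟩
  have := natAbs_sub_le_dist1 v 0 i
  simp only [Pi.zero_apply, sub_zero] at this
  exact abs_le.2 ⟨by omega, by omega⟩

/-- Every nonzero lattice point has a unit step towards the origin. -/
theorem exists_unit_dist1_sub {v : Lat D} {n : ℕ} (h : dist1 v 0 = n + 1) :
    ∃ e : Lat D, Adjacent 0 e ∧ dist1 (v - e) 0 = n := by
  have hne : ∃ i, v i ≠ 0 := by
    by_contra! hv
    have : v = 0 := funext hv
    rw [this, dist1_self] at h
    omega
  obtain ⟨i, hi⟩ := hne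
  refine ⟨Pi.single i (v i).sign, ?_, ?_⟩
  · rw [Adjacent, dist1, Finset.sum_eq_single i]
    · simp [Int.natAbs_sign_of_ne_zero hi]
    · intro j _ hj
      simp [hj]
    · simp
  · have key : dist1 (v - Pi.single i (v i).sign) 0 + 1 = dist1 v 0 := by
      unfold dist1
      rw [← Finset.add_sum_erase _ _ (Finset.mem_univ i),
        ← Finset.add_sum_erase Finset.univ _ (Finset.mem_univ i), add_right_comm]
      congr 1
      · simp only [Pi.sub_apply, Pi.single_eq_same, Pi.zero_apply, sub_zero]
        rcases lt_or_gt_of_ne hi with h0 | h0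
        · rw [Int.sign_eq_neg_one_of_neg h0]; omega
        · rw [Int.sign_eq_one_of_pos h0]; omega
      · refine Finset.sum_congr rfl fun j hj => ?_
        simp [Finset.ne_of_mem_erase hj]
    omega

end Lattice

/-! ### Compactness: finite range and finite windows. -/

section Compactness

variable {D : ℕ} {A : Type*} [Finite A] [TopologicalSpace A]

theorem finite_range_of_continuous {B : Type*} [TopologicalSpace B] [DiscreteTopology B]
    {K : Set (Config D A)} (hK : IsClosed K) {f : K → B} (hf : Continuous f) :
    (Set.range f).Finite := by
  have := isCompact_iff_compactSpace.1 hK.isCompact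
  exact (isCompact_range hf).finite_of_discrete

variable [DiscreteTopology A] in
/-- A continuous map from a closed set of configurations to a discrete space is determined by a
finite window. -/
theorem exists_radius {B : Type*} [TopologicalSpace B] [DiscreteTopology B]
    {K : Set (Config D A)} (hK : IsClosed K) {f : K → B} (hf : Continuous f) :
    ∃ r : ℕ, ∀ x y : K, (∀ v ∈ cube D r, x.1 v = y.1 v) → f x = f y := by
  have := isCompact_iff_compactSpace.1 hK.isCompact
  by_contra! hne
  -- The pairs that agree on the `n`-cube but are separated by `f` form nested nonempty compact
  -- sets. A point in all of them is a pair of equal configurations with different values.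
  let T : ℕ → Set (K × K) := fun n =>
    {p | (∀ v ∈ cube D n, p.1.1 v = p.2.1 v) ∧ f p.1 ≠ f p.2}
  have hclosed : ∀ n, IsClosed (T n) := by
    intro n
    refine IsClosed.inter ?_ ?_
    · have : {p : K × K | ∀ v ∈ cube D n, p.1.1 v = p.2.1 v} =
          ⋂ v ∈ cube D n, {p : K × K | p.1.1 v = p.2.1 v} := by
        ext p; simp
      change IsClosed {p : K × K | ∀ v ∈ cube D n, p.1.1 v = p.2.1 v}
      rw [this]
      refine isClosed_biInter fun v _ => isClosed_eq
        ((continuous_apply v).comp (continuous_subtype_val.comp continuous_fst))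
        ((continuous_apply v).comp (continuous_subtype_val.comp continuous_snd))
    · have hc : Continuous fun p : K × K => (f p.1, f p.2) := by fun_prop
      exact (isClosed_discrete {q : B × B | q.1 ≠ q.2}).preimage hc
  have hn := IsCompact.nonempty_iInter_of_sequence_nonempty_isCompact_isClosed T
    (fun n p hp => ⟨fun v hv => hp.1 v (cube_mono n.le_succ hv), hp.2⟩)
    (fun n => by
      obtain ⟨x, y, h1, h2⟩ := hne n
      exact ⟨(x, y), h1, h2⟩)
    (hclosed 0).isCompact hclosed
  obtain ⟨p, hp⟩ := hn
  rw [Set.mem_iInter] at hp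
  refine (hp 0).2 (congrArg f (Subtype.ext (funext fun v => ?_)))
  obtain ⟨r, hr⟩ := exists_mem_cube v
  exact (hp r).1 v hr

end Compactness

/-! ### Blocks of the subshift and the defect field. -/

section Unflawed

variable {D : ℕ} {A : Type*} [TopologicalSpace A] {S : Subshift D A} {a : Config D A}

namespace Subshift

theorem Matches.mono {r s : ℕ} {z : Lat D} {x : S.carrier} (h : S.Matches s a z x)
    (hrs : r ≤ s) : S.Matches r a z x := fun v hv => h v (cube_mono hrs hv)

theorem Matches.shiftOn {r s : ℕ} {z u : Lat D} {x : S.carrier} (h : S.Matches (r + s) a z x)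
    (hu : u ∈ cube D s) : S.Matches r a (z + u) (S.shiftOn u x) := fun v hv => by
  have := h _ (add_mem_cube hv hu)
  rw [add_assoc, add_comm u v, ← this]
  rfl

theorem Matches.mem_unflawed {r : ℕ} {z : Lat D} {x : S.carrier} (h : S.Matches r a z x) :
    z ∈ S.unflawed r a := by
  rw [Subshift.unflawed, Set.mem_ofPred_eq, Subshift.defectField]
  exact le_sSup ⟨r, rfl, x, h⟩

/-- Positivity of `r` matters: the supremum of the empty set is 0, so every point is unflawed of
range 0, even where no block matches. -/
theorem exists_matches {r : ℕ} (hr : 0 < r) {z : Lat D} (hz : z ∈ S.unflawed r a) :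
    ∃ x, S.Matches r a z x := by
  have h1 : ((r - 1 : ℕ) : ℕ∞) < S.defectField a z :=
    lt_of_lt_of_le (by exact_mod_cast Nat.sub_lt hr one_pos) hz
  obtain ⟨_, ⟨s, rfl, x, hx⟩, hs⟩ := lt_sSup_iff.1 h1
  have hs' : r - 1 < s := by exact_mod_cast hs
  exact ⟨x, hx.mono (by omega)⟩

theorem unflawed_anti {r s : ℕ} (h : r ≤ s) : S.unflawed s a ⊆ S.unflawed r a :=
  fun _ hz =>
  le_trans (show (r : ℕ∞) ≤ s by exact_mod_cast h) hz

theorem mem_slightlyDefective_iff :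
    a ∈ S.slightlyDefective ↔ ∀ n : ℕ, ∃ z, z ∈ S.unflawed n a := by
  constructor
  · intro h n
    have h1 : ((n : ℕ) : ℕ∞) < ⨆ z, S.defectField a z := by
      rw [show (⨆ z, S.defectField a z) = ⊤ from h]
      exact ENat.natCast_lt_top n
    obtain ⟨z, hz⟩ := lt_iSup_iff.1 h1
    exact ⟨z, hz.le⟩
  · intro h
    refine ENat.eq_top_iff_forall_ge.2 fun n => ?_
    obtain ⟨z, hz⟩ := h n
    exact le_trans hz (le_iSup _ z)

end Subshift

end Unflawed

/-! ### Iterates of a cellular automaton and their action on cohomology. -/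

section Iterates

namespace CellularAutomaton

variable {D : ℕ} {A : Type*} [TopologicalSpace A]

/-- The iterates of a cellular automaton. -/
def iterate (Φ : CellularAutomaton D A) (t : ℕ) :
    CellularAutomaton D A where
  toFun := Φ.toFun^[t]
  continuous := Φ.continuous.iterate t
  comm v a := (Function.Commute.iterate_left (fun a => Φ.comm v a) t) a

theorem iterate_preserves (Φ : CellularAutomaton D A) {S : Subshift D A} (hΦ : Φ.Preserves S)
    (t : ℕ) : (Φ.iterate t).Preserves S :=
  fun _ hx => (show Set.MapsTo Φ.toFun S.carrier S.carrier from hΦ).iterate t hx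

theorem surjective_inducedMap_iterate {G : Type*} [Group G] [TopologicalSpace G]
    [IsTopologicalGroup G] (Φ : CellularAutomaton D A) {S : Subshift D A} (hΦ : Φ.Preserves S)
    (h : Function.Surjective (Φ.inducedMap hΦ : H1dy S G → H1dy S G)) (t : ℕ) :
    Function.Surjective
      ((Φ.iterate t).inducedMap (Φ.iterate_preserves hΦ t) : H1dy S G → H1dy S G) := by
  induction t with
  | zero => exact fun c => ⟨c, by induction c using Quotient.ind; rfl⟩
  | succ t ih =>
    -- Pullback is functorial, already at the level of cocycles.
    have hcomp : ((Φ.iterate (t + 1)).inducedMap (Φ.iterate_preserves hΦ (t + 1)) :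
        H1dy S G → H1dy S G) =
        Φ.inducedMap hΦ ∘ (Φ.iterate t).inducedMap (Φ.iterate_preserves hΦ t) := by
      funext c
      induction c using Quotient.ind
      rfl
    rw [hcomp]
    exact h.comp ih

end CellularAutomaton

end Iterates

/-! ### Finite windows of cellular automata. -/

section Automata

variable {D : ℕ} {A : Type*} [Finite A] [TopologicalSpace A] [DiscreteTopology A]

namespace CellularAutomaton

/-- The Curtis–Hedlund–Lyndon theorem: a cellular automaton has a finite window. -/
theorem exists_window (Φ : CellularAutomaton D A) : ∃ q : ℕ, ∀ (m : ℕ) (x y : Config D A),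
    (∀ v ∈ cube D (m + q), x v = y v) → ∀ v ∈ cube D m, Φ.toFun x v = Φ.toFun y v := by
  obtain ⟨q, hq⟩ := exists_radius (K := (Set.univ : Set (Config D A))) isClosed_univ
    (f := fun x => Φ.toFun x.1 0)
    ((continuous_apply 0).comp (Φ.continuous.comp continuous_subtype_val))
  refine ⟨q, fun m x y h v hv => ?_⟩
  have h0 : ∀ x : Config D A, Φ.toFun x v = Φ.toFun (shift v x) 0 := fun x => by
    rw [Φ.comm]; simp [shift]
  rw [h0, h0]
  refine hq ⟨shift v x, trivial⟩ ⟨shift v y, trivial⟩ fun u hu => h _ ?_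
  rw [add_comm m q]
  exact add_mem_cube hu hv

theorem exists_window_matches (Φ : CellularAutomaton D A) : ∃ q : ℕ, ∀ {S : Subshift D A}
    (hΦ : Φ.Preserves S) (m : ℕ) (a : Config D A) (z : Lat D) (x : S.carrier),
    S.Matches (m + q) a z x → S.Matches m (Φ.toFun a) z (Φ.restrict hΦ x) := by
  obtain ⟨q, hq⟩ := Φ.exists_window
  refine ⟨q, fun hΦ m a z x hx v hv => ?_⟩
  have := hq m x.1 (shift z a) (fun u hu => by rw [hx u hu, shift, add_comm]) v hv
  rw [Φ.comm, shift, add_comm] at this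
  exact this

theorem toFun_mem_slightlyDefective (Φ : CellularAutomaton D A) {S : Subshift D A}
    (hΦ : Φ.Preserves S) {a : Config D A} (ha : a ∈ S.slightlyDefective) :
    Φ.toFun a ∈ S.slightlyDefective := by
  obtain ⟨q, hq⟩ := Φ.exists_window_matches
  rw [Subshift.mem_slightlyDefective_iff] at ha ⊢
  intro n
  -- The window costs `q`; the extra 1 keeps the radius positive, as `exists_matches` demands.
  obtain ⟨z, hz⟩ := ha (n + 1 + q)
  obtain ⟨x, hx⟩ := Subshift.exists_matches (by omega) hz
  exact ⟨z, Subshift.unflawed_anti n.le_succ (hq hΦ _ a z x hx).mem_unflawed⟩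

end CellularAutomaton

end Automata

/-! ### Elementary identities and local determination of cocycles. -/

namespace Cocycle

variable {D : ℕ} {A : Type*} [TopologicalSpace A] {S : Subshift D A}
  {G : Type*} [Group G] [TopologicalSpace G]

theorem shiftOn_zero (x : S.carrier) : S.shiftOn 0 x = x :=
  Subtype.ext (funext fun z => by simp [Subshift.shiftOn, shift])

theorem zero_apply (C : Cocycle S G) (x : S.carrier) : C.toFun 0 x = 1 := by
  have := C.cocycle 0 0 x
  rw [shiftOn_zero, add_zero] at this
  exact left_eq_mul.1 this

theorem sub_apply (C : Cocycle S G) (y z : Lat D) (x : S.carrier) :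
    C.toFun (y - z) (S.shiftOn z x) = C.toFun y x * (C.toFun z x)⁻¹ := by
  rw [eq_mul_inv_iff_mul_eq, ← C.cocycle, sub_add_cancel]

theorem continuous_apply (C : Cocycle S G) (e : Lat D) : Continuous (C.toFun e) :=
  C.continuous.comp (continuous_const.prodMk continuous_id)

variable [Finite A] [DiscreteTopology A] [DiscreteTopology G]

theorem exists_hasRadius (C : Cocycle S G) : ∃ ρ, C.HasRadius ρ := by
  choose r hr using fun e => exists_radius S.isClosed (C.continuous_apply e)
  obtain ⟨ρ, hρ⟩ := ((finite_units D).image r).bddAbove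
  exact ⟨ρ, fun e he x y h => hr e x y fun v hv =>
    h v (cube_mono (hρ ⟨e, he, rfl⟩) hv)⟩

end Cocycle

/-! ### Pseudonorm estimates. -/

section Norms

variable {G : Type*} [Group G] (N : Pseudonorm G)

/-- Rotating `v` to the front by `N.comm` brings `u` and `v` together, so a factor inserted between
them costs only its own pseudonorm. -/
theorem Pseudonorm.conj_le (u g v : G) : N.toFun (u * g * v) ≤ N.toFun (u * v) + N.toFun g := by
  rw [N.comm, ← mul_assoc, N.comm u v]
  exact N.subadd _ _

theorem Pseudonorm.mul_mul_le (u g v : G) :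
    N.toFun (u * g * v) ≤ N.toFun u + N.toFun g + N.toFun v :=
  (N.subadd _ _).trans (add_le_add_left (N.subadd _ _) _)

theorem Pseudonorm.exists_bound {T : Set G} (hT : T.Finite) :
    ∃ B, ∀ g ∈ T, N.toFun g ≤ B ∧ N.toFun g⁻¹ ≤ B := by
  obtain ⟨B, hB⟩ := (hT.image fun g => N.toFun g ⊔ N.toFun g⁻¹).bddAbove
  refine ⟨B, fun g hg => ?_⟩
  exact sup_le_iff.1 (hB ⟨g, hg, rfl⟩)

variable {D : ℕ} {A : Type*} [Finite A] [TopologicalSpace A]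
  {S : Subshift D A} [TopologicalSpace G] [DiscreteTopology G]

theorem Cocycle.exists_unit_bound (C : Cocycle S G) :
    ∃ M, N.toFun 1 ≤ M ∧ ∀ e, Adjacent 0 e → ∀ x,
      N.toFun (C.toFun e x) ≤ M ∧ N.toFun (C.toFun e x)⁻¹ ≤ M := by
  have hfin : (⋃ e ∈ {e : Lat D | Adjacent 0 e}, Set.range (C.toFun e)).Finite :=
    (finite_units D).biUnion fun e _ =>
      finite_range_of_continuous S.isClosed (C.continuous_apply e)
  -- The identity is included because a pseudonorm need not vanish there.
  obtain ⟨M, hM⟩ := N.exists_bound (hfin.insert 1)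
  exact ⟨M, (hM 1 (Set.mem_insert _ _)).1, fun e he x => hM _ (Set.mem_insert_of_mem _
    (Set.mem_biUnion (show e ∈ {e : Lat D | Adjacent 0 e} from he) ⟨x, rfl⟩))⟩

theorem Cocycle.exists_linear_bound (C : Cocycle S G) :
    ∃ M, ∀ v x, N.toFun (C.toFun v x) ≤ M * dist1 v 0 + M := by
  obtain ⟨M, h1, hM⟩ := C.exists_unit_bound N
  refine ⟨M, fun v => ?_⟩
  generalize hn : dist1 v 0 = n
  induction n generalizing v with
  | zero =>
    intro x
    rw [eq_of_dist1_eq_zero hn, C.zero_apply]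
    simpa using h1
  | succ n ih =>
    intro x
    obtain ⟨e, he, hv⟩ := exists_unit_dist1_sub hn
    have h2 : C.toFun v x = C.toFun (v - e) (S.shiftOn e x) * C.toFun e x := by
      rw [← C.cocycle, sub_add_cancel]
    rw [h2]
    refine (N.subadd _ _).trans ((add_le_add (ih _ hv _) (hM e he x).1).trans_eq ?_)
    push_cast
    ring

end Norms

end CADefects
namespace CADefects

/-! ### Trails and trail components. -/

section TrailLemmas

variable {D : ℕ} {T Y : Set (Lat D)} {x y z : Lat D} {ζ ξ : List (Lat D)}

namespace IsTrail

theorem mono (h : IsTrail Y x y ζ) (hY : Y ⊆ T) : IsTrail T x y ζ :=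
  ⟨h.chain, fun z hz => hY (h.mem z hz), h.head, h.last⟩

theorem single (hx : x ∈ Y) : IsTrail Y x x [x] :=
  ⟨by simp, by simpa using hx, rfl, rfl⟩

theorem cons (hx : x ∈ Y) (hxy : Adjacent x y) (h : IsTrail Y y z ζ) :
    IsTrail Y x z (x :: ζ) := by
  obtain ⟨hc, hm, hh, hl⟩ := h
  match ζ, hh with
  | w :: ζ, hh =>
    obtain rfl : w = y := by simpa using hh
    exact ⟨List.isChain_cons_cons.2 ⟨hxy, hc⟩, by simpa [hx] using hm, rfl, by simpa using hl⟩

theorem pair (hx : x ∈ Y) (hy : y ∈ Y) (hxy : Adjacent x y) : IsTrail Y x y [x, y] :=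
  (single hy).cons hx hxy

/-- Induction on trails, from the last point. -/
theorem induct {P : Lat D → List (Lat D) → Prop} (h : IsTrail Y x y ζ)
    (hsingle : y ∈ Y → P y [y])
    (hcons : ∀ x w ζ, x ∈ Y → Adjacent x w → IsTrail Y w y (w :: ζ) → P w (w :: ζ) →
      P x (x :: w :: ζ)) : P x ζ := by
  induction ζ generalizing x with
  | nil => simpa using h.head
  | cons u ζ ih =>
    obtain ⟨hc, hm, hh, hl⟩ := h
    obtain rfl : u = x := by simpa using hh
    cases ζ with
    | nil =>
      obtain rfl : u = y := by simpa using hl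
      exact hsingle (hm u (by simp))
    | cons w ζ =>
      rw [List.isChain_cons_cons] at hc
      have ht : IsTrail Y w y (w :: ζ) :=
        ⟨hc.2, fun z hz => hm z (List.mem_cons_of_mem _ hz), rfl, by simpa using hl⟩
      exact hcons u w ζ (hm u (by simp)) hc.1 ht (ih ht)

theorem left_mem (h : IsTrail Y x y ζ) : x ∈ Y :=
  h.mem x (List.mem_of_mem_head? h.head)

theorem right_mem (h : IsTrail Y x y ζ) : y ∈ Y :=
  h.mem y (List.mem_of_mem_getLast? h.last)

theorem trans (h : IsTrail Y x y ζ) (h' : IsTrail Y y z ξ) : IsTrail Y x z (ζ ++ ξ.tail) := by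
  refine h.induct (P := fun x ζ => IsTrail Y x z (ζ ++ ξ.tail)) (fun _ => ?_)
    fun x w ζ hx hxw _ ih => ih.cons hx hxw
  have : ξ = y :: ξ.tail := List.eq_cons_of_mem_head? h'.head
  rw [List.singleton_append, ← this]
  exact h'

theorem reverse (h : IsTrail Y x y ζ) : IsTrail Y y x ζ.reverse :=
  ⟨List.isChain_reverse.2 (h.chain.imp fun _ _ h => h.symm),
    fun z hz => h.mem z (List.mem_reverse.1 hz), by rw [List.head?_reverse, h.last],
    by rw [List.getLast?_reverse, h.head]⟩

theorem dist1_lt_length (h : IsTrail Y x y ζ) : dist1 x y + 1 ≤ ζ.length := by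
  refine h.induct (P := fun x ζ => dist1 x y + 1 ≤ ζ.length) (fun _ => by simp [dist1_self])
    fun x w ζ _ hxw _ ih => ?_
  have h1 := dist1_triangle x w y
  have h2 : dist1 x w = 1 := hxw
  simp only [List.length_cons] at ih ⊢
  omega

/-- A trail stays in every set that is closed under adjacency within its ambient set. -/
theorem restrict (h : IsTrail T x y ζ) (hx : x ∈ Y)
    (hY : ∀ z ∈ Y, ∀ w ∈ T, Adjacent z w → w ∈ Y) : IsTrail Y x y ζ := by
  revert hx
  refine h.induct (P := fun x ζ => x ∈ Y → IsTrail Y x y ζ) (fun _ => single)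
    fun x w ζ _ hxw ht ih hx => (ih (hY x hx w ht.left_mem hxw)).cons hx hxw

end IsTrail

namespace IsComponent

theorem subset (hY : IsComponent T Y) : Y ⊆ T := by
  obtain ⟨x, _, rfl⟩ := hY
  rintro y ⟨ζ, h⟩
  exact h.right_mem

theorem mem_of_adjacent (hY : IsComponent T Y) (hy : y ∈ Y) (hz : z ∈ T) (h : Adjacent y z) :
    z ∈ Y := by
  obtain ⟨x, _, rfl⟩ := hY
  obtain ⟨ζ, hζ⟩ := hy
  exact ⟨_, hζ.trans (IsTrail.pair hζ.right_mem hz h)⟩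

theorem restrict_trail (hY : IsComponent T Y) (hx : x ∈ Y) (h : IsTrail T x y ζ) :
    IsTrail Y x y ζ :=
  h.restrict hx fun _ hz _ hw hzw => hY.mem_of_adjacent hz hw hzw

theorem exists_trail (hY : IsComponent T Y) (hy : y ∈ Y) (hz : z ∈ Y) :
    ∃ ζ, IsTrail Y y z ζ := by
  have hY' := hY
  obtain ⟨x, _, rfl⟩ := hY
  obtain ⟨ζ, hζ⟩ := hy
  obtain ⟨ξ, hξ⟩ := hz
  exact ⟨_, hY'.restrict_trail ⟨ζ, hζ⟩ (hζ.reverse.trans hξ)⟩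

end IsComponent

end TrailLemmas

/-! ### Products of the local rule along trails, and potentials. -/

namespace Cocycle

variable {D : ℕ} {A : Type*} [TopologicalSpace A] {S : Subshift D A}
  {G : Type*} [Group G] [TopologicalSpace G] {C : Cocycle S G} {r ρ : ℕ} {a : Config D A}
  {Y : Set (Lat D)} {x y z w : Lat D} {ζ ξ : List (Lat D)}

theorem localRule_eq (hC : C.HasRadius ρ) (hr : ρ ≤ r) {e : Lat D} (he : Adjacent 0 e)
    {x : S.carrier} (hx : S.Matches r a z x) : C.localRule r a e z = C.toFun e x := by
  have h : ∃ x, S.Matches r a z x := ⟨x, hx⟩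
  rw [localRule, dif_pos h]
  exact hC e he _ _ fun v hv => by
    rw [h.choose_spec v (cube_mono hr hv), hx v (cube_mono hr hv)]

/-- Two consecutive steps of a trail, evaluated in the block around the first point. -/
theorem localRule_mul_localRule (hC : C.HasRadius ρ) (hr : ρ < r) (hzw : Adjacent z w)
    (hwy : Adjacent w y) {x : S.carrier} (hx : S.Matches r a z x) (hw : w ∈ S.unflawed r a) :
    C.localRule r a (y - w) w * C.localRule r a (w - z) z = C.toFun (y - z) x := by
  obtain ⟨x', hx'⟩ := Subshift.exists_matches (by omega) hw
  -- Moving one step from `z` to `w` costs one unit of radius; this is where `ρ < r` is needed.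
  have h2 : S.Matches ρ a w (S.shiftOn (w - z) x) := by
    have := (hx.mono (r := ρ + 1) hr).shiftOn hzw.sub.mem_cube_one
    rwa [add_sub_cancel] at this
  have h3 : C.toFun (y - w) x' = C.toFun (y - w) (S.shiftOn (w - z) x) :=
    hC _ hwy.sub _ _ fun v hv => by rw [hx' v (cube_mono hr.le hv), h2 v hv]
  rw [localRule_eq hC hr.le hzw.sub hx, localRule_eq hC hr.le hwy.sub hx', h3, ← C.cocycle,
    sub_add_sub_cancel]

theorem localRule_swap (hC : C.HasRadius ρ) (hr : ρ < r) (hzw : Adjacent z w)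
    (hz : z ∈ S.unflawed r a) (hw : w ∈ S.unflawed r a) :
    C.localRule r a (z - w) w = (C.localRule r a (w - z) z)⁻¹ := by
  obtain ⟨x, hx⟩ := Subshift.exists_matches (by omega) hz
  rw [eq_inv_iff_mul_eq_one, localRule_mul_localRule hC hr hzw hzw.symm hx hw, sub_self,
    C.zero_apply]

theorem alongTrail_append (l m : List (Lat D)) (z : Lat D) :
    C.alongTrail r a (l ++ z :: m) = C.alongTrail r a (z :: m) * C.alongTrail r a (l ++ [z]) := by
  induction l with
  | nil => simp [alongTrail]
  | cons u l ih =>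
    cases l with
    | nil => simp [alongTrail]
    | cons v l =>
      simp only [List.cons_append, alongTrail] at ih ⊢
      rw [ih, mul_assoc]

theorem alongTrail_trans (h : IsTrail Y x y ζ) (h' : IsTrail Y y z ξ) :
    C.alongTrail r a (ζ ++ ξ.tail) = C.alongTrail r a ξ * C.alongTrail r a ζ := by
  obtain ⟨l, rfl⟩ : ∃ l, ζ = l ++ [y] := List.getLast?_eq_some_iff.1 h.last
  have hξ : ξ = y :: ξ.tail := List.eq_cons_of_mem_head? h'.head
  rw [List.append_assoc, List.singleton_append, alongTrail_append, ← hξ]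

theorem alongTrail_reverse (hC : C.HasRadius ρ) (hr : ρ < r) (hY : Y ⊆ S.unflawed r a)
    (h : IsTrail Y x y ζ) : C.alongTrail r a ζ.reverse = (C.alongTrail r a ζ)⁻¹ := by
  refine h.induct (P := fun _ ζ => C.alongTrail r a ζ.reverse = (C.alongTrail r a ζ)⁻¹)
    (fun _ => by simp [alongTrail]) fun x w ζ hx hxw ht ih => ?_
  have h1 := alongTrail_trans (C := C) (r := r) (a := a) ht.reverse
    (IsTrail.pair ht.left_mem hx hxw.symm)
  rw [List.reverse_cons, alongTrail, mul_inv_rev, ← ih, ← localRule_swap hC hr hxw (hY hx)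
    (hY ht.left_mem)]
  simpa [alongTrail] using h1

/-- By the cocycle law two consecutive steps contribute a value depending only on their outer
endpoints, so the middle vertex is irrelevant. A backtrack contributes `C.toFun 0 = 1`. -/
theorem alongTrail_eq_of_elemHomotopy (hC : C.HasRadius ρ) (hr : ρ < r)
    (hY : Y ⊆ S.unflawed r a) (h : IsTrail Y x y ζ) (h' : IsTrail Y x y ξ)
    (hh : ElemHomotopy ζ ξ) : C.alongTrail r a ζ = C.alongTrail r a ξ := by
  have key : ∀ {l m : List (Lat D)} {u v w : Lat D}, IsTrail Y x y (l ++ u :: v :: w :: m) →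
      ∀ {s}, S.Matches r a u s → C.alongTrail r a (l ++ u :: v :: w :: m) =
        C.alongTrail r a (w :: m) * C.toFun (w - u) s * C.alongTrail r a (l ++ [u]) := by
    intro l m u v w ht s hs
    have hc := (List.isChain_append.1 ht.chain).2.1
    simp only [List.isChain_cons_cons] at hc
    rw [alongTrail_append, alongTrail, alongTrail, mul_assoc (C.alongTrail r a (w :: m)),
      localRule_mul_localRule hC hr hc.1 hc.2.1 hs (hY (ht.mem v (by simp)))]
  have hex : ∀ u ∈ Y, ∃ s, S.Matches r a u s := fun u hu =>
    Subshift.exists_matches (by omega) (hY hu)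
  cases hh with
  | swap l m w v v' u =>
    obtain ⟨s, hs⟩ := hex w (h.mem w (by simp))
    rw [key h hs, key h' hs]
  | delete l m w v =>
    obtain ⟨s, hs⟩ := hex w (h.mem w (by simp))
    rw [key h hs, sub_self, C.zero_apply, mul_one, ← alongTrail_append]
  | insert l m w v =>
    obtain ⟨s, hs⟩ := hex w (h.mem w (by simp))
    rw [key h' hs, sub_self, C.zero_apply, mul_one, ← alongTrail_append]

theorem alongTrail_eq_of_trailHomotopic (hC : C.HasRadius ρ) (hr : ρ < r)
    (hY : Y ⊆ S.unflawed r a) (h : TrailHomotopic Y x y ζ ξ) :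
    C.alongTrail r a ζ = C.alongTrail r a ξ := by
  induction h with
  | refl => rfl
  | tail _ h ih => exact ih.trans (alongTrail_eq_of_elemHomotopy hC hr hY h.1 h.2.1 h.2.2)

/-- In a simply connected set, the value along a trail depends only on the endpoints. -/
theorem alongTrail_eq_of_trivialPi1 (hC : C.HasRadius ρ) (hr : ρ < r)
    (hY : Y ⊆ S.unflawed r a) (hπ : TrivialPi1 Y) (h : IsTrail Y x y ζ) (h' : IsTrail Y x y ξ) :
    C.alongTrail r a ζ = C.alongTrail r a ξ := by
  -- One trail followed by the reverse of the other is a null-homotopic loop, whose value is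
  -- therefore 1.
  have h1 := alongTrail_eq_of_trailHomotopic hC hr hY (hπ x _ (h.trans h'.reverse))
  rw [alongTrail_trans h h'.reverse, alongTrail_reverse hC hr hY h'] at h1
  exact (inv_mul_eq_one.1 h1).symm

/-- `h` is a potential for the local rule of range `r` on the set `Y`. -/
def IsPotentialOn (C : Cocycle S G) (r : ℕ) (a : Config D A) (Y : Set (Lat D))
    (h : Lat D → G) : Prop :=
  ∀ z ∈ Y, ∀ w ∈ Y, Adjacent z w → C.localRule r a (w - z) z = h w * (h z)⁻¹

namespace IsPotentialOn

variable {h h' : Lat D → G}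

theorem alongTrail_eq (hh : C.IsPotentialOn r a Y h) (ht : IsTrail Y z y ζ) :
    C.alongTrail r a ζ = h y * (h z)⁻¹ := by
  refine ht.induct (P := fun z ζ => C.alongTrail r a ζ = h y * (h z)⁻¹)
    (fun _ => by simp [alongTrail]) fun z w ζ hz hzw ht ih => ?_
  rw [alongTrail, ih, hh z hz w ht.left_mem hzw]
  group

theorem diffWithin_eq (hh : C.IsPotentialOn r a Y h) (ht : ∃ ζ, IsTrail Y z y ζ) :
    C.diffWithin r a Y y z = h y * (h z)⁻¹ := by
  rw [diffWithin, dif_pos ht]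
  exact hh.alongTrail_eq ht.choose_spec

end IsPotentialOn

/-- The potential integrates the local rule from a base point. Path independence lets the chosen
trail to `w` be replaced by the one to `z` followed by the edge from `z` to `w`. -/
theorem exists_isPotentialOn (hC : C.HasRadius ρ) (hr : ρ < r)
    (hY : IsComponent (S.unflawed r a) Y) (hπ : TrivialPi1 Y) :
    ∃ h, C.IsPotentialOn r a Y h := by
  have hY' := hY
  obtain ⟨p, hp, hYp⟩ := hY'
  have hpY : p ∈ Y := hYp ▸ ⟨_, IsTrail.single hp⟩
  choose! τ hτ using fun y (hy : y ∈ Y) => hY.exists_trail hpY hy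
  refine ⟨fun y => C.alongTrail r a (τ y), fun z hz w hw hzw => ?_⟩
  have hpair := IsTrail.pair hz hw hzw
  have := alongTrail_eq_of_trivialPi1 hC hr hY.subset hπ (hτ w hw) ((hτ z hz).trans hpair)
  beta_reduce
  rw [this, alongTrail_trans (hτ z hz) hpair]
  simp [alongTrail]

end Cocycle

end CADefects
namespace CADefects

/-! ### Block potentials of linear growth exclude gaps. -/

section Growth

variable {D : ℕ} {A : Type*} [TopologicalSpace A] {S : Subshift D A}
  {G : Type*} [Group G] [TopologicalSpace G] (N : Pseudonorm G)

/-- The differences of `h` grow at most linearly. -/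
def LinearGrowth (h : Lat D → G) : Prop :=
  ∃ M B : ℝ≥0, ∀ y z, N.toFun (h y * (h z)⁻¹) ≤ M * dist1 y z + B

/-- `h` is a potential for the cocycle `C`, evaluated in the blocks of `a` of radius `R`. -/
def IsBlockPotential (C : Cocycle S G) (R : ℕ) (a : Config D A) (h : Lat D → G) : Prop :=
  ∀ z ∈ S.unflawed R a, ∀ w ∈ S.unflawed R a, Adjacent z w → ∀ x, S.Matches R a z x →
    C.toFun (w - z) x = h w * (h z)⁻¹

variable {N} {C : Cocycle S G} {a : Config D A} {r R ρ : ℕ} {h : Lat D → G}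

theorem IsBlockPotential.isPotentialOn (hh : IsBlockPotential C R a h) (hC : C.HasRadius ρ)
    (hρ : ρ < r) (hR : R ≤ r) : C.IsPotentialOn r a (S.unflawed r a) h := by
  intro z hz w hw hzw
  obtain ⟨x, hx⟩ := Subshift.exists_matches (by omega) hz
  rw [Cocycle.localRule_eq hC hρ.le hzw.sub hx]
  exact hh z (Subshift.unflawed_anti hR hz) w (Subshift.unflawed_anti hR hw) hzw x (hx.mono hR)

theorem Cocycle.IsPotentialOn.mono {Y Y' : Set (Lat D)} (hh : C.IsPotentialOn r a Y h)
    (hY : Y' ⊆ Y) : C.IsPotentialOn r a Y' h :=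
  fun z hz w hw => hh z (hY hz) w (hY hw)

theorem tilt_ne_top {Y₁ Y₂ : Set (Lat D)} {p₁ p₂ : Lat D} {K : ℝ≥0}
    (hK : ∀ y₁ ∈ Y₁, ∀ y₂ ∈ Y₂,
      N.toFun (C.diffWithin r a Y₁ y₁ p₁ * C.diffWithin r a Y₂ p₂ y₂) ≤ K * dist1 y₁ y₂) :
    tilt N C r a Y₁ Y₂ p₁ p₂ ≠ ⊤ := by
  refine ne_top_of_le_ne_top (ENNReal.coe_ne_top (r := K))
    (iSup₂_le fun y₁ h₁ => iSup₂_le fun y₂ h₂ => ENNReal.div_le_of_le_mul ?_)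
  exact_mod_cast hK y₁ h₁ y₂ h₂

theorem IsComponent.one_le_dist1 {T Y₁ Y₂ : Set (Lat D)} {y₁ y₂ : Lat D}
    (h₁ : IsComponent T Y₁) (h₂ : IsComponent T Y₂) (hne : Y₁ ≠ Y₂) (hy₁ : y₁ ∈ Y₁)
    (hy₂ : y₂ ∈ Y₂) : 1 ≤ dist1 y₁ y₂ := by
  by_contra hd
  obtain rfl := eq_of_dist1_eq_zero (show dist1 y₁ y₂ = 0 by omega)
  have aux : ∀ {U V : Set (Lat D)}, IsComponent T U → IsComponent T V → y₁ ∈ U → y₁ ∈ V →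
      U ⊆ V := fun hU hV hyU hyV u hu => by
    obtain ⟨ζ, hζ⟩ := hU.exists_trail hyU hu
    exact (hV.restrict_trail hyV (hζ.mono hU.subset)).right_mem
  exact hne ((aux h₁ h₂ hy₁ hy₂).antisymm (aux h₂ h₁ hy₂ hy₁))

/-- A block potential of linear growth excludes gaps of large range. -/
theorem IsBlockPotential.not_isGapOfRange (hh : IsBlockPotential C R a h)
    (hg : LinearGrowth N h) (hR : R ≤ r) : ¬ IsGapOfRange N C r a := by
  rintro ⟨-, ⟨ρ, hρ, hC⟩, Y₁, Y₂, ⟨hY₁, -⟩, ⟨hY₂, -⟩, hne, -, -, p₁, hp₁, p₂, hp₂, htop⟩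
  have hpot := hh.isPotentialOn hC hρ hR
  obtain ⟨M, B, hMB⟩ := hg
  -- The additive constants can join the slope because distinct components are at distance at least
  -- 1.
  refine tilt_ne_top (K := M + B + N.toFun ((h p₁)⁻¹ * h p₂)) (fun y₁ hy₁ y₂ hy₂ => ?_) htop
  rw [(hpot.mono hY₁.subset).diffWithin_eq (hY₁.exists_trail hp₁ hy₁),
    (hpot.mono hY₂.subset).diffWithin_eq (hY₂.exists_trail hy₂ hp₂),
    show h y₁ * (h p₁)⁻¹ * (h p₂ * (h y₂)⁻¹) = h y₁ * ((h p₁)⁻¹ * h p₂) * (h y₂)⁻¹ by group]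
  have hd : (1 : ℝ≥0) ≤ dist1 y₁ y₂ := by
    exact_mod_cast hY₁.one_le_dist1 hY₂ hne hy₁ hy₂
  calc _ ≤ N.toFun (h y₁ * (h y₂)⁻¹) + N.toFun ((h p₁)⁻¹ * h p₂) := N.conj_le _ _ _
    _ ≤ M * dist1 y₁ y₂ + B * 1 + N.toFun ((h p₁)⁻¹ * h p₂) * 1 := by
      rw [mul_one, mul_one]
      exact add_le_add_left (hMB _ _) _
    _ ≤ M * dist1 y₁ y₂ + B * dist1 y₁ y₂ + N.toFun ((h p₁)⁻¹ * h p₂) * dist1 y₁ y₂ := by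
      gcongr
    _ = _ := by ring

/-- Two potentials differ by finitely many factors, if the unflawed region of the larger range has
finitely many components. -/
theorem finite_potential_quotient (hS : Sharp S a) (hF : FinitelyManyDomains S a)
    {Y : Set (Lat D)} (hY : IsComponent (S.unflawed r a) Y) (hrR : r ≤ R) {h₁ : Lat D → G}
    (h₁Y : C.IsPotentialOn r a Y h₁) (hh : C.IsPotentialOn r a (S.unflawed R a) h) :
    ((fun x => (h x)⁻¹ * h₁ x) '' (Y ∩ S.unflawed R a)).Finite := by
  let comp : Lat D → Set (Lat D) := fun x => {y | ∃ ζ, IsTrail (S.unflawed R a) x y ζ}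
  have hcomp : ∀ x ∈ S.unflawed R a, comp x ∈ {Y | IsProjectiveComponent S R a Y} := by
    -- Sharpness makes every component projective: from any point a trail inside the region reaches
    -- each larger range.
    refine fun x hx => ⟨⟨x, hx, rfl⟩, fun R' hR' => ?_⟩
    obtain ⟨K, hK⟩ := hS R R' hR'
    obtain ⟨y, hy, ζ, hζ, -⟩ := hK x hx
    exact ⟨y, ⟨ζ, hζ⟩, hy⟩
  have hconst : ∀ x ∈ Y ∩ S.unflawed R a, ∀ x' ∈ Y ∩ S.unflawed R a, comp x = comp x' →
      (h x)⁻¹ * h₁ x = (h x')⁻¹ * h₁ x' := by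
    rintro x ⟨hxY, hx⟩ x' ⟨hxY', hx'⟩ hxx
    obtain ⟨ζ, hζ⟩ : x' ∈ comp x := hxx ▸ ⟨_, IsTrail.single hx'⟩
    -- Both potentials compute the same product along a trail of the larger range, so `h⁻¹ * h₁` has
    -- equal values at its ends.
    have e1 := h₁Y.alongTrail_eq
      (hY.restrict_trail hxY (hζ.mono (Subshift.unflawed_anti hrR)))
    rw [hh.alongTrail_eq hζ, mul_inv_eq_iff_eq_mul] at e1
    rw [e1]
    group
  have hfin : (comp '' (Y ∩ S.unflawed R a)).Finite := by
    refine (hF R).subset ?_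
    rintro _ ⟨x, hx, rfl⟩
    exact hcomp x hx.2
  choose! σ hσ using fun c (hc : c ∈ comp '' (Y ∩ S.unflawed R a)) => hc
  refine (hfin.image fun c => (h (σ c))⁻¹ * h₁ (σ c)).subset ?_
  rintro _ ⟨x, hx, rfl⟩
  have hc : comp x ∈ comp '' (Y ∩ S.unflawed R a) := ⟨x, hx, rfl⟩
  exact ⟨comp x, hc, hconst _ (hσ _ hc).1 _ hx (hσ _ hc).2⟩

theorem mem_slightlyDefective_of_gap (h : HasGap S N a ∨ HasSharpGap S N a) :
    a ∈ S.slightlyDefective := by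
  rcases h with ⟨C, hC⟩ | ⟨-, -, C, r, hC⟩
  · obtain ⟨r, -, hgap⟩ := hC 0
    exact hgap.1
  · exact hC.1

variable [Finite A] [DiscreteTopology G]

/-- Counting vertices rather than steps leaves room for the pseudonorm of the identity. Inverses are
bounded separately, since a pseudonorm need not be invariant under inversion. -/
theorem exists_alongTrail_bound (N : Pseudonorm G) (hC : C.HasRadius ρ) (hr : ρ < r) :
    ∃ M, ∀ x y ζ, IsTrail (S.unflawed r a) x y ζ →
      N.toFun (C.alongTrail r a ζ) ≤ M * ζ.length ∧
      N.toFun (C.alongTrail r a ζ)⁻¹ ≤ M * ζ.length := by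
  obtain ⟨M, h1, hM⟩ := C.exists_unit_bound N
  refine ⟨M, fun x y ζ ht => ht.induct (P := fun _ ζ =>
    N.toFun (C.alongTrail r a ζ) ≤ M * ζ.length ∧ N.toFun (C.alongTrail r a ζ)⁻¹ ≤ M * ζ.length)
    (fun _ => by simpa [Cocycle.alongTrail] using h1) fun x w ζ hx hxw ht ih => ?_⟩
  obtain ⟨s, hs⟩ := Subshift.exists_matches (by omega) hx
  have hs' := hM _ hxw.sub s
  rw [Cocycle.alongTrail, Cocycle.localRule_eq hC hr.le hxw.sub hs, List.length_cons, mul_inv_rev]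
  push_cast at ih ⊢
  refine ⟨(N.subadd _ _).trans ((add_le_add ih.1 hs'.1).trans_eq (by ring)),
    (N.subadd _ _).trans ((add_le_add hs'.2 ih.2).trans_eq (by ring))⟩

/-- A block potential of linear growth excludes gaps if the domain boundary is sharp. -/
theorem IsBlockPotential.not_isGapOfRange_of_sharp (hh : IsBlockPotential C R a h)
    (hg : LinearGrowth N h) (hS : Sharp S a) (hF : FinitelyManyDomains S a) :
    ¬ IsGapOfRange N C r a := by
  rintro ⟨-, ⟨ρ, hρ, hC⟩, Y₁, Y₂, ⟨hY₁, -⟩, ⟨hY₂, -⟩, hne, hπ₁, hπ₂, p₁, hp₁, p₂, hp₂, htop⟩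
  obtain ⟨h₁, hpot₁⟩ := Cocycle.exists_isPotentialOn hC hρ hY₁ hπ₁
  obtain ⟨h₂, hpot₂⟩ := Cocycle.exists_isPotentialOn hC hρ hY₂ hπ₂
  have hrR : r ≤ max r R := le_max_left _ _
  -- The rule keeps its radius `r`, while the points have range at least `R`. The two readings agree
  -- since `C` only sees radius `ρ < r`.
  have hpot : C.IsPotentialOn r a (S.unflawed (max r R) a) h := by
    intro z hz w hw hzw
    obtain ⟨x, hx⟩ := Subshift.exists_matches (by omega) hz
    rw [Cocycle.localRule_eq hC hρ.le hzw.sub (hx.mono hrR)]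
    exact hh z (Subshift.unflawed_anti (le_max_right _ _) hz) w
      (Subshift.unflawed_anti (le_max_right _ _) hw) hzw x (hx.mono (le_max_right _ _))
  obtain ⟨M, B, hMB⟩ := hg
  obtain ⟨K, hK⟩ := hS r _ hrR
  obtain ⟨M', hM'⟩ := exists_alongTrail_bound (a := a) N hC hρ
  set g := (h₁ p₁)⁻¹ * h₂ p₂ with hgdef
  -- Only finitely many middle factors can occur between `h x₁` and `(h x₂)⁻¹` below.
  obtain ⟨B', hB'⟩ := N.exists_bound
    ((finite_potential_quotient hS hF hY₁ hrR hpot₁ hpot).image2 (fun k₁ k₂ => k₁ * g * k₂⁻¹)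
      (finite_potential_quotient hS hF hY₂ hrR hpot₂ hpot))
  have hmove : ∀ {Y : Set (Lat D)} {h' : Lat D → G}, IsComponent (S.unflawed r a) Y →
      C.IsPotentialOn r a Y h' → ∀ y ∈ Y, ∃ x ∈ Y ∩ S.unflawed (max r R) a,
        dist1 y x ≤ K ∧ N.toFun (h' x * (h' y)⁻¹) ≤ M' * (K + 1) ∧
        N.toFun (h' y * (h' x)⁻¹) ≤ M' * (K + 1) := by
    intro Y h' hY hpot' y hy
    obtain ⟨x, hx, ζ, hζ, hlen⟩ := hK y (hY.subset hy)
    have hζY := hY.restrict_trail hy hζ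
    have hd := hζ.dist1_lt_length
    have hb := hM' y x ζ hζ
    rw [hpot'.alongTrail_eq hζY, mul_inv_rev, inv_inv] at hb
    have hlen' : M' * (ζ.length : ℝ≥0) ≤ M' * (K + 1) := by
      gcongr
      exact_mod_cast hlen
    exact ⟨x, ⟨hζY.right_mem, hx⟩, by omega, hb.1.trans hlen', hb.2.trans hlen'⟩
  refine tilt_ne_top (K := M + (M * (2 * K) + B + B' + 2 * (M' * (K + 1))))
    (fun y₁ hy₁ y₂ hy₂ => ?_) htop
  obtain ⟨x₁, hx₁, hd₁, -, hn₁⟩ := hmove hY₁ hpot₁ y₁ hy₁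
  obtain ⟨x₂, hx₂, hd₂, hn₂, -⟩ := hmove hY₂ hpot₂ y₂ hy₂
  have hk := (hB' _ (Set.mem_image2_of_mem ⟨x₁, hx₁, rfl⟩ ⟨x₂, hx₂, rfl⟩)).1
  have hd : (1 : ℝ≥0) ≤ dist1 y₁ y₂ := by
    exact_mod_cast hY₁.one_le_dist1 hY₂ hne hy₁ hy₂
  have hdx : (dist1 x₁ x₂ : ℝ≥0) ≤ dist1 y₁ y₂ + 2 * K := by
    have e1 := dist1_triangle x₁ y₁ x₂
    have e2 := dist1_triangle y₁ y₂ x₂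
    rw [dist1_comm x₁ y₁] at e1
    exact_mod_cast (show dist1 x₁ x₂ ≤ dist1 y₁ y₂ + 2 * K by omega)
  rw [hpot₁.diffWithin_eq (hY₁.exists_trail hp₁ hy₁),
    hpot₂.diffWithin_eq (hY₂.exists_trail hy₂ hp₂),
    show h₁ y₁ * (h₁ p₁)⁻¹ * (h₂ p₂ * (h₂ y₂)⁻¹) =
      h₁ y₁ * (h₁ x₁)⁻¹ *
      (h x₁ * ((h x₁)⁻¹ * h₁ x₁ * g * ((h x₂)⁻¹ * h₂ x₂)⁻¹) * (h x₂)⁻¹) *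
      (h₂ x₂ * (h₂ y₂)⁻¹) by rw [hgdef]; group]
  calc _ ≤ N.toFun (h₁ y₁ * (h₁ x₁)⁻¹) +
        N.toFun (h x₁ * ((h x₁)⁻¹ * h₁ x₁ * g * ((h x₂)⁻¹ * h₂ x₂)⁻¹) * (h x₂)⁻¹) +
        N.toFun (h₂ x₂ * (h₂ y₂)⁻¹) := N.mul_mul_le _ _ _
    _ ≤ M' * (K + 1) + ((M * (dist1 y₁ y₂ + 2 * K) + B) + B') + M' * (K + 1) := by
      refine add_le_add (add_le_add hn₁ ((N.conj_le _ _ _).trans (add_le_add ?_ hk))) hn₂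
      exact (hMB _ _).trans (by gcongr)
    _ = M * dist1 y₁ y₂ + (M * (2 * K) + B + B' + 2 * (M' * (K + 1))) * 1 := by ring
    _ ≤ M * dist1 y₁ y₂ + (M * (2 * K) + B + B' + 2 * (M' * (K + 1))) * dist1 y₁ y₂ := by
      gcongr
    _ = _ := by ring

/-- In a configuration with a gap, no cocycle has block potentials of linear growth. -/
theorem not_hasGap_of_forall_blockPotential
    (H : ∀ C : Cocycle S G, ∃ R h, IsBlockPotential C R a h ∧ LinearGrowth N h) :
    ¬ (HasGap S N a ∨ HasSharpGap S N a) := by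
  rintro (⟨C, hC⟩ | ⟨hS, hF, C, r, hC⟩)
  · obtain ⟨R, h, hh, hg⟩ := H C
    obtain ⟨r, hr, hgap⟩ := hC R
    exact hh.not_isGapOfRange hg hr hgap
  · obtain ⟨R, h, hh, hg⟩ := H C
    exact hh.not_isGapOfRange_of_sharp hg hS hF hC

/-- Along an orbit, a cocycle grows linearly, also after a bounded change by a transfer function. -/
theorem Cocycle.linearGrowth (N : Pseudonorm G) (C : Cocycle S G) (x : S.carrier)
    {β : Lat D → G} (hβ : (Set.range β).Finite) :
    LinearGrowth N fun y => β y * C.toFun y x := by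
  obtain ⟨M, hM⟩ := C.exists_linear_bound N
  obtain ⟨B, hB⟩ := N.exists_bound hβ
  refine ⟨M, B + M + B, fun y z => ?_⟩
  rw [show β y * C.toFun y x * (β z * C.toFun z x)⁻¹ =
    β y * (C.toFun y x * (C.toFun z x)⁻¹) * (β z)⁻¹ by group, ← C.sub_apply]
  refine (N.mul_mul_le _ _ _).trans ((add_le_add (add_le_add (hB _ ⟨y, rfl⟩).1 (hM _ _))
    (hB _ ⟨z, rfl⟩).2).trans_eq ?_)
  rw [dist1_sub_zero]
  ring

/-! ### Block potentials from a repaired configuration or from an image in the subshift. -/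

variable [DiscreteTopology A]

theorem exists_blockPotential_of_removable (hr : S.Removable a) (C : Cocycle S G) :
    ∃ R h, IsBlockPotential C R a h ∧ LinearGrowth N h := by
  obtain ⟨r, -, a', ha', heq⟩ := hr
  obtain ⟨ρ, hρ⟩ := C.exists_hasRadius
  -- Around a point of range `r + ρ`, the whole cube of radius `ρ` is unflawed of range `r`, so `a'`
  -- agrees with `a` on all that `C` sees.
  refine ⟨r + ρ, fun y => 1 * C.toFun y ⟨a', ha'⟩, fun z _ w _ hzw x hx => ?_,
    C.linearGrowth N _ (β := fun _ => 1) (Set.finite_range_const)⟩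
  simp only [one_mul]
  rw [← C.sub_apply]
  refine hρ _ hzw.sub _ _ fun v hv => ?_
  rw [hx v (cube_mono (by omega) hv), ← heq _ (hx.shiftOn hv).mem_unflawed, add_comm]
  rfl

theorem exists_blockPotential_of_mem [IsTopologicalGroup G] {Φ : CellularAutomaton D A}
    (hΦ : Φ.Preserves S)
    (hsurj : Function.Surjective (Φ.inducedMap hΦ : H1dy S G → H1dy S G))
    (ha : Φ.toFun a ∈ S.carrier) (C : Cocycle S G) :
    ∃ R h, IsBlockPotential C R a h ∧ LinearGrowth N h := by
  obtain ⟨c, hc⟩ := hsurj (Quotient.mk _ C)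
  obtain ⟨C', rfl⟩ := Quotient.exists_rep c
  obtain ⟨b, hb, hbC⟩ : (Φ.pullCocycle hΦ C').Cohomologous C := Quotient.exact hc
  obtain ⟨ρ, hρ⟩ := C'.exists_hasRadius
  obtain ⟨s, hs⟩ := exists_radius S.isClosed hb
  obtain ⟨q, hq⟩ := Φ.exists_window_matches
  have hex : ∀ z ∈ S.unflawed (max (ρ + q) (s + 1)) a, ∃ x,
      S.Matches (max (ρ + q) (s + 1)) a z x :=
    fun z hz => Subshift.exists_matches (by omega) hz
  have : Nonempty S.carrier := ⟨⟨_, ha⟩⟩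
  -- `ξ y` represents the block at `y`; `b (ξ y)` does not depend on the choice where the range is
  -- large. Elsewhere `ξ` is arbitrary, which the finite range of `b` makes harmless for growth.
  choose! ξ hξ using hex
  -- Radius `ρ + q` controls the image on the window of `C'`; radius `s + 1` still covers the window
  -- of `b` after a step to a neighbour.
  refine ⟨max (ρ + q) (s + 1), fun y => b (ξ y) * C'.toFun y ⟨_, ha⟩,
    fun z hz w hw hzw x hx => ?_, C'.linearGrowth N _ ((finite_range_of_continuous S.isClosed
      hb).subset (Set.range_comp_subset_range ξ b))⟩
  have hbeq : ∀ {u x}, u ∈ S.unflawed (max (ρ + q) (s + 1)) a → S.Matches s a u x →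
      b x = b (ξ u) := fun hu hx => hs _ _ fun v hv => by
    rw [hx v hv, hξ _ hu v (cube_mono (by omega) hv)]
  have hxw : S.Matches s a w (S.shiftOn (w - z) x) := by
    have := (hx.mono (r := s + 1) (le_max_right _ _)).shiftOn hzw.sub.mem_cube_one
    rwa [add_sub_cancel] at this
  have hC' : C'.toFun (w - z) (Φ.restrict hΦ x) =
      C'.toFun (w - z) (S.shiftOn z ⟨_, ha⟩) :=
    hρ _ hzw.sub _ _ fun v hv => by
      rw [hq hΦ ρ a z x (hx.mono (le_max_left _ _)) v hv, add_comm]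
      rfl
  rw [hbC, hbeq hw hxw, hbeq hz (hx.mono (by omega))]
  change b (ξ w) * C'.toFun (w - z) (Φ.restrict hΦ x) * (b (ξ z))⁻¹ = _
  rw [hC', C'.sub_apply]
  group

end Growth

end CADefects

theorem theorem2p10 {D : ℕ} {A : Type*} [Finite A] [TopologicalSpace A] [DiscreteTopology A]
    {G : Type*} [Group G] [TopologicalSpace G] [DiscreteTopology G] [IsTopologicalGroup G]
    (S : CADefects.Subshift D A) (N : CADefects.Pseudonorm G) :
    (∀ a, CADefects.HasGap S N a ∨ CADefects.HasSharpGap S N a → S.Essential a) ∧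
    (∀ (Φ : CADefects.CellularAutomaton D A) (hΦ : Φ.Preserves S),
      Function.Surjective (Φ.inducedMap hΦ : CADefects.H1dy S G → CADefects.H1dy S G) →
        ∀ a, CADefects.HasGap S N a ∨ CADefects.HasSharpGap S N a → S.Persistent Φ a) := by
  refine ⟨fun a ha => ⟨CADefects.mem_slightlyDefective_of_gap ha, fun hr => ?_⟩,
    fun Φ hΦ hsurj a ha t => ⟨?_, fun hmem => ?_⟩⟩
  · exact CADefects.not_hasGap_of_forall_blockPotential
      (CADefects.exists_blockPotential_of_removable hr) ha
  · exact (Φ.iterate t).toFun_mem_slightlyDefective (Φ.iterate_preserves hΦ t)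
      (CADefects.mem_slightlyDefective_of_gap ha)
  · exact CADefects.not_hasGap_of_forall_blockPotential
      (CADefects.exists_blockPotential_of_mem (Φ.iterate_preserves hΦ t)
        (Φ.surjective_inducedMap_iterate hΦ hsurj t) hmem) ha
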